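/- Let $k\ge 0$ and $n\ge 1$, let $F(k)$ be the free group on $k$ generators $x_1,\dots,x_k$ with identity $e$, and let $t_1,\dots,t_n$ be group terms in the variables $x_1,\dots,x_k$, each of which also denotes the element of $F(k)$ that it represents. For a subset $S$ of a group, write $\langle S\rangle$ for the subsemigroup generated by $S$. A right order of a group $G$ is a total order $\le$ on $G$ such that $a\le b$ implies $ac\le bc$ for all $a,b,c\in G$; a subset $S\subseteq G$ extends to a right order of $G$ if there is a right order $\le$ of $G$ with $e<a$ for all $a\in S$. A lattice-ordered group ($\ell$-group) is a group $L$ with a lattice order such that $a\le b$ implies $cad\le cbd$ for all $a,b,c,d\in L$. Then the following are equivalent: (1) The inequality $e\le t_1\vee\dots\vee t_n$ is valid in all $\ell$-groups, i.e. it holds in every $\ell$-group under every assignment of elements to the variables $x_1,\dots,x_k$. (2) $\{t_1,\dots,t_n\}$ does not extend to a right order of $F(k)$. (3) There exist $m\ge 0$ and $s_1,\dots,s_m\in F(k)\setminus\{e\}$ such that $e\in\langle\{t_1,\dots,t_n,s_1^{\delta_1},\dots,s_m^{\delta_m}\}\rangle$ for all $\delta_1,\dots,\delta_m\in\{-1,1\}$.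 -/

import Mathlib

universe u

/-- Group terms over the variables `x_0, …, x_{k-1}`. -/
inductive GroupTerm (k : ℕ) : Type
  | var : Fin k → GroupTerm k
  | one : GroupTerm k
  | mul : GroupTerm k → GroupTerm k → GroupTerm k
  | inv : GroupTerm k → GroupTerm k

/-- The value of a group term in a group under an assignment of the variables. -/
def GroupTerm.eval {k : ℕ} {G : Type*} [Group G] (v : Fin k → G) : GroupTerm k → G
  | .var i => v i
  | .one => 1
  | .mul s t => s.eval v * t.eval v
  | .inv t => (t.eval v)⁻¹

/-- The element of the free group `F(k)` that a group term represents. -/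
def GroupTerm.toFree {k : ℕ} (t : GroupTerm k) : FreeGroup (Fin k) :=
  t.eval FreeGroup.of

/-- The inequality `e ≤ t_1 ∨ … ∨ t_n` (with `n ≥ 1`) is valid in all lattice-ordered groups
(with carrier in the universe `u`), i.e. it holds under every assignment of the variables.
A lattice-ordered group is a group and a lattice in which all left and right translations
are monotone. -/
def ValidInLGroups {k n : ℕ} [NeZero n] (t : Fin n → GroupTerm k) : Prop :=
  ∀ (L : Type u) [Group L] [Lattice L] [MulLeftMono L] [MulRightMono L] (v : Fin k → L),
    1 ≤ Finset.univ.sup' Finset.univ_nonempty (fun i => (t i).eval v)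

/-- `le` is a partial right order of the group `G`. -/
structure IsPartialRightOrder {G : Type*} [Group G] (le : G → G → Prop) : Prop where
  refl : ∀ a, le a a
  trans : ∀ a b c, le a b → le b c → le a c
  antisymm : ∀ a b, le a b → le b a → a = b
  mul_right : ∀ a b c, le a b → le (a * c) (b * c)

/-- The (strict) positive cone `{a | e < a}` of a relation `le`. -/
def positiveCone {G : Type*} [Group G] (le : G → G → Prop) : Set G :=
  {a | le 1 a ∧ a ≠ 1}

/-- A (total) right order: a partial right order with `G = P ∪ P⁻¹ ∪ {e}`. -/
structure IsRightOrder {G : Type*} [Group G] (le : G → G → Prop) : Prop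
    extends IsPartialRightOrder le where
  total : ∀ a, a ∈ positiveCone le ∨ a⁻¹ ∈ positiveCone le ∨ a = 1

/-- The subset `S` extends to a right order of `G`: it lies in the positive cone of one. -/
def ExtendsToRightOrder {G : Type*} [Group G] (S : Set G) : Prop :=
  ∃ le : G → G → Prop, IsRightOrder le ∧ S ⊆ positiveCone le

/-! ### Right orders and their positive cones -/

section RightOrder

variable {G : Type*} [Group G]

theorem IsRightOrder.mul_mem_positiveCone {le : G → G → Prop} (h : IsRightOrder le) {a b : G}
    (ha : a ∈ positiveCone le) (hb : b ∈ positiveCone le) : a * b ∈ positiveCone le := by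
  have hab : le b (a * b) := by simpa using h.mul_right 1 a b ha.1
  refine ⟨h.trans _ _ _ hb.1 hab, fun hab1 => hb.2 ?_⟩
  rw [hab1] at hab
  exact h.antisymm _ _ hab hb.1

theorem IsRightOrder.one_notMem_closure {le : G → G → Prop} (h : IsRightOrder le) {S : Set G}
    (hS : S ⊆ positiveCone le) : (1 : G) ∉ Subsemigroup.closure S := by
  intro h1
  have hle : Subsemigroup.closure S ≤ ⟨positiveCone le, h.mul_mem_positiveCone⟩ :=
    Subsemigroup.closure_le.2 hS
  exact (hle h1).2 rfl

/-- A subsemigroup that contains `a` or `a⁻¹` for every `a ≠ 1`, and not `1`, extends to a right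
order. -/
theorem Subsemigroup.extendsToRightOrder (P : Subsemigroup G) (h1 : (1 : G) ∉ P)
    (htot : ∀ a : G, a ≠ 1 → a ∈ P ∨ a⁻¹ ∈ P) : ExtendsToRightOrder (P : Set G) := by
  refine ⟨fun a b => b * a⁻¹ ∈ P ∨ a = b, ⟨⟨fun a => Or.inr rfl, ?_, ?_, ?_⟩, ?_⟩, ?_⟩
  · rintro a b c (hab | rfl) (hbc | rfl)
    · exact Or.inl (by simpa [mul_assoc] using P.mul_mem hbc hab)
    · exact Or.inl hab
    · exact Or.inl hbc
    · exact Or.inr rfl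
  · rintro a b (hab | rfl) (hba | hba)
    · exact absurd (by simpa [mul_assoc] using P.mul_mem hba hab) h1
    · exact hba.symm
    · rfl
    · rfl
  · rintro a b c (hab | rfl)
    · exact Or.inl (by simpa [mul_assoc] using hab)
    · exact Or.inr rfl
  · intro a
    by_cases ha : a = 1
    · exact Or.inr (Or.inr ha)
    · rcases htot a ha with h | h
      · exact Or.inl ⟨Or.inl (by simpa using h), ha⟩
      · exact Or.inr (Or.inl ⟨Or.inl (by simpa using h), inv_ne_one.2 ha⟩)
  · intro a ha
    exact ⟨Or.inl (by simpa using ha), fun h => h1 (h ▸ ha)⟩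

theorem ExtendsToRightOrder.mono {S T : Set G} (hST : S ⊆ T) (hT : ExtendsToRightOrder T) :
    ExtendsToRightOrder S :=
  let ⟨le, hle, h⟩ := hT
  ⟨le, hle, hST.trans h⟩

theorem IsRightOrder.exists_zpow_mem_positiveCone {le : G → G → Prop} (h : IsRightOrder le)
    {a : G} (ha : a ≠ 1) : ∃ δ : ℤˣ, a ^ (δ : ℤ) ∈ positiveCone le := by
  rcases h.total a with h | h | h
  · exact ⟨1, by simpa using h⟩
  · exact ⟨-1, by simpa using h⟩
  · exact absurd h ha

/-- An element of the subsemigroup generated by `S` and the values of `f` lies in the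
subsemigroup generated by `S` and finitely many values of `f`. -/
theorem Subsemigroup.exists_finset_mem_closure_union {M α : Type*} [Semigroup M] {S : Set M}
    {A : Set α} {f : α → M} {x : M} (hx : x ∈ Subsemigroup.closure (S ∪ f '' A)) :
    ∃ B : Finset α, ↑B ⊆ A ∧ x ∈ Subsemigroup.closure (S ∪ f '' B) := by
  classical
  induction hx using Subsemigroup.closure_induction with
  | mem x hx =>
    rcases hx with hx | ⟨a, ha, rfl⟩
    · exact ⟨∅, by simp, Subsemigroup.subset_closure (Or.inl hx)⟩
    · exact ⟨{a}, by simpa using ha, Subsemigroup.subset_closure (Or.inr ⟨a, by simp, rfl⟩)⟩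
  | mul x y _ _ ihx ihy =>
    obtain ⟨B, hB, hxB⟩ := ihx
    obtain ⟨C, hC, hyC⟩ := ihy
    refine ⟨B ∪ C, by simp [hB, hC], Subsemigroup.mul_mem _ ?_ ?_⟩
    · refine Subsemigroup.closure_mono (Set.union_subset_union_right _ (Set.image_mono ?_)) hxB
      simp
    · refine Subsemigroup.closure_mono (Set.union_subset_union_right _ (Set.image_mono ?_)) hyC
      simp

/-- A set extends to a right order as soon as, for any finitely many non-identity elements, signs
can be chosen such that the set together with the signed elements generates a subsemigroup that
avoids the identity. -/
theorem extendsToRightOrder_of_forall_finset {S : Set G}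
    (h : ∀ A : Finset G, 1 ∉ A → ∃ δ : G → ℤˣ,
      (1 : G) ∉ Subsemigroup.closure (S ∪ (fun a => a ^ (δ a : ℤ)) '' A)) :
    ExtendsToRightOrder S := by
  classical
  choose g hg using fun A : Finset G => h (A.erase 1) (Finset.notMem_erase 1 A)
  obtain ⟨χ, hχ⟩ := Finset.rado_selection g
  refine ExtendsToRightOrder.mono (Set.subset_union_left.trans Subsemigroup.subset_closure)
    (Subsemigroup.extendsToRightOrder
      (Subsemigroup.closure (S ∪ (fun a => a ^ (χ a : ℤ)) '' {1}ᶜ)) ?_ ?_)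
  · intro h1
    obtain ⟨B, hB, h1B⟩ := Subsemigroup.exists_finset_mem_closure_union h1
    obtain ⟨C, hBC, hC⟩ := hχ B
    refine hg C (Subsemigroup.closure_mono (Set.union_subset_union_right _ ?_) h1B)
    rintro _ ⟨b, hb, rfl⟩
    refine ⟨b, ?_, by simp only [hC b hb]⟩
    exact Finset.mem_coe.2 (Finset.mem_erase.2 ⟨hB hb, hBC hb⟩)
  · intro a ha
    have hmem : a ^ (χ a : ℤ) ∈ Subsemigroup.closure (S ∪ (fun a => a ^ (χ a : ℤ)) '' {1}ᶜ) :=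
      Subsemigroup.subset_closure (Or.inr ⟨a, ha, rfl⟩)
    rcases Int.units_eq_one_or (χ a) with h | h <;> rw [h] at hmem
    · exact Or.inl (by simpa using hmem)
    · exact Or.inr (by simpa using hmem)

/-- The algebraic criterion for a set not to extend to a right order. -/
theorem not_extendsToRightOrder_iff (S : Set G) :
    ¬ ExtendsToRightOrder S ↔
      ∃ (m : ℕ) (s : Fin m → G), (∀ j, s j ≠ 1) ∧ ∀ δ : Fin m → ℤˣ,
        (1 : G) ∈ Subsemigroup.closure (S ∪ Set.range fun j => s j ^ (δ j : ℤ)) := by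
  classical
  constructor
  · intro hS
    by_contra! hcon
    refine hS (extendsToRightOrder_of_forall_finset fun A hA => ?_)
    obtain ⟨δ, hδ⟩ := hcon A.card (fun j => A.equivFin.symm j)
      (fun j hj => hA (hj ▸ (A.equivFin.symm j).2))
    refine ⟨fun a => if ha : a ∈ A then δ (A.equivFin ⟨a, ha⟩) else 1, fun h1 => hδ ?_⟩
    refine Subsemigroup.closure_mono (Set.union_subset_union_right _ ?_) h1
    rintro _ ⟨a, ha, rfl⟩
    rw [Finset.mem_coe] at ha
    exact ⟨A.equivFin ⟨a, ha⟩, by simp [ha]⟩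
  · rintro ⟨m, s, hs, h⟩ ⟨le, hle, hS⟩
    choose δ hδ using fun j => hle.exists_zpow_mem_positiveCone (hs j)
    refine hle.one_notMem_closure (Set.union_subset hS ?_) (h δ)
    rintro _ ⟨j, rfl⟩
    exact hδ j

end RightOrder

/-! ### Free groups are right orderable -/

section Free

variable {G : Type*} [Group G] [IsFreeGroup G]

/-- A nontrivial free group has a nontrivial homomorphism to `ℤ`. -/
theorem IsFreeGroup.exists_hom_int_ne_one [Nontrivial G] :
    ∃ χ : G →* Multiplicative ℤ, χ ≠ 1 := by
  rcases isEmpty_or_nonempty (IsFreeGroup.Generators G) with h | ⟨⟨i⟩⟩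
  · have := (IsFreeGroup.toFreeGroup G).toEquiv.subsingleton
    exact absurd this (not_subsingleton G)
  · refine ⟨IsFreeGroup.lift fun _ => Multiplicative.ofAdd 1, fun h => ?_⟩
    have h1 := DFunLike.congr_fun h (IsFreeGroup.of i)
    rw [IsFreeGroup.lift_of] at h1
    exact absurd (congrArg Multiplicative.toAdd h1) (by simp)

/-- On the subgroup generated by a set `A ⊄ {1}` of a free group there is an additive function
to `ℤ` that does not vanish on `A`. -/
theorem IsFreeGroup.exists_additive_ne_zero {A : Set G} {a₀ : G} (ha₀ : a₀ ∈ A) (h1 : a₀ ≠ 1) :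
    ∃ f : G → ℤ, (∀ x ∈ Subgroup.closure A, ∀ y ∈ Subgroup.closure A, f (x * y) = f x + f y) ∧
      ∃ a ∈ A, f a ≠ 0 := by
  classical
  have : Nontrivial (Subgroup.closure A) :=
    ⟨⟨⟨a₀, Subgroup.subset_closure ha₀⟩, 1, fun h => h1 (congrArg Subtype.val h)⟩⟩
  obtain ⟨χ, hχ⟩ := IsFreeGroup.exists_hom_int_ne_one (G := Subgroup.closure A)
  refine ⟨fun x => if hx : x ∈ Subgroup.closure A then Multiplicative.toAdd (χ ⟨x, hx⟩) else 0,
    fun x hx y hy => ?_, ?_⟩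
  · simp only [hx, hy, mul_mem hx hy, dif_pos]
    rw [← toAdd_mul, ← map_mul]
    rfl
  · by_contra! hcon
    refine hχ (MonoidHom.eq_of_eqOn_dense Subgroup.closure_closure_coe_preimage ?_)
    rintro ⟨a, ha⟩ haA
    have := hcon a haA
    simp only [ha, dif_pos] at this
    simpa using this

theorem IsFreeGroup.exists_signs (A : Finset G) (hA : 1 ∉ A) :
    ∃ δ : G → ℤˣ, (1 : G) ∉ Subsemigroup.closure ((fun a => a ^ (δ a : ℤ)) '' (A : Set G)) := by
  classical
  induction A using Finset.strongInduction with
  | H A ih =>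
    rcases A.eq_empty_or_nonempty with rfl | ⟨a₀, ha₀⟩
    · exact ⟨1, by simp [Subsemigroup.notMem_bot]⟩
    obtain ⟨f, hf, a, ha, hfa⟩ := IsFreeGroup.exists_additive_ne_zero (A := (A : Set G))
      (Finset.mem_coe.2 ha₀) (fun h => hA (h ▸ ha₀))
    have hf1 : f 1 = 0 := by simpa using hf 1 (one_mem _) 1 (one_mem _)
    have hfinv : ∀ x ∈ Subgroup.closure (A : Set G), f x⁻¹ = - f x := fun x hx => by
      have := hf x hx x⁻¹ (inv_mem hx)
      rw [mul_inv_cancel, hf1] at this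
      linarith
    obtain ⟨δ, hδ⟩ := ih (A.filter fun a => f a = 0)
      (Finset.filter_ssubset.2 ⟨a, ha, hfa⟩) (fun h => hA (Finset.mem_of_mem_filter _ h))
    let ε : G → ℤˣ := fun a => if f a = 0 then δ a else if 0 < f a then 1 else -1
    refine ⟨ε, fun h1 => ?_⟩
    have key : ∀ g ∈ Subsemigroup.closure ((fun a => a ^ (ε a : ℤ)) '' (A : Set G)),
        g ∈ Subgroup.closure (A : Set G) ∧ (0 < f g ∨ f g = 0 ∧ g ∈ Subsemigroup.closure
          ((fun a => a ^ (δ a : ℤ)) '' (A.filter fun a => f a = 0 : Finset G))) := by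
      intro g hg
      induction hg using Subsemigroup.closure_induction with
      | mem x hx =>
        obtain ⟨b, hb, rfl⟩ := hx
        have hbA : b ∈ Subgroup.closure (A : Set G) := Subgroup.subset_closure hb
        refine ⟨zpow_mem hbA _, ?_⟩
        by_cases hb0 : f b = 0
        · right
          simp only [ε, if_pos hb0]
          refine ⟨?_, Subsemigroup.subset_closure ⟨b, by simp_all, rfl⟩⟩
          rcases Int.units_eq_one_or (δ b) with h | h <;> simp [h, hb0, hfinv b hbA]
        · left
          by_cases hpos : 0 < f b
          · simp [ε, hb0, hpos]
          · have : f b < 0 := lt_of_le_of_ne (not_lt.1 hpos) hb0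
            simpa [ε, hb0, hpos, hfinv b hbA] using this
      | mul x y _ _ ihx ihy =>
        obtain ⟨hx, hx'⟩ := ihx
        obtain ⟨hy, hy'⟩ := ihy
        refine ⟨mul_mem hx hy, ?_⟩
        rw [hf x hx y hy]
        rcases hx' with hx' | ⟨hx0, hx'⟩ <;> rcases hy' with hy' | ⟨hy0, hy'⟩
        · left; linarith
        · left; linarith
        · left; linarith
        · exact Or.inr ⟨by linarith, mul_mem hx' hy'⟩
    rcases (key 1 h1).2 with h | ⟨-, h⟩
    · exact absurd hf1 h.ne'
    · exact hδ h

theorem IsFreeGroup.exists_isRightOrder : ∃ le : G → G → Prop, IsRightOrder le := by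
  obtain ⟨le, hle, -⟩ := extendsToRightOrder_of_forall_finset (G := G) (S := ∅) fun A hA => by
    simpa using IsFreeGroup.exists_signs A hA
  exact ⟨le, hle⟩

end Free

/-! ### Total right preorders on lattice-ordered groups -/

section LatticeOrderedGroup

variable {L : Type*} [Group L] [Lattice L]

/-- A convex submonoid of the cone `{a | 1 ≤ a}`. -/
structure Submonoid.IsConvexPositive (N : Submonoid L) : Prop where
  one_le : ∀ a ∈ N, 1 ≤ a
  mem_of_le : ∀ a b, 1 ≤ a → a ≤ b → b ∈ N → a ∈ N

theorem Submonoid.exists_maximal_isConvexPositive {b : L} (hb : b ≠ 1) :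
    ∃ N : Submonoid L, Maximal (fun N : Submonoid L => N.IsConvexPositive ∧ b ∉ N) N := by
  have hbot : (⊥ : Submonoid L).IsConvexPositive ∧ b ∉ (⊥ : Submonoid L) := by
    refine ⟨⟨fun a ha => (Submonoid.mem_bot.1 ha).ge, fun a d h1 had hd => ?_⟩,
      fun h => hb (Submonoid.mem_bot.1 h)⟩
    rw [Submonoid.mem_bot] at hd ⊢
    exact le_antisymm (had.trans hd.le) h1
  refine (zorn_le_nonempty₀ {N : Submonoid L | N.IsConvexPositive ∧ b ∉ N}
    (fun c hc hchain y hy => ?_) ⊥ hbot).imp fun N hN => hN.2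
  have hmem : ∀ x, x ∈ sSup c ↔ ∃ N ∈ c, x ∈ N := fun x =>
    Submonoid.mem_sSup_of_directedOn ⟨y, hy⟩ hchain.directedOn
  refine ⟨sSup c, ⟨⟨fun a ha => ?_, fun a d h1 had hd => ?_⟩, fun hbc => ?_⟩,
    fun z hz => le_sSup hz⟩
  · obtain ⟨N, hN, ha⟩ := (hmem a).1 ha
    exact (hc hN).1.one_le a ha
  · obtain ⟨N, hN, hd⟩ := (hmem d).1 hd
    exact (hmem a).2 ⟨N, hN, (hc hN).1.mem_of_le a d h1 had hd⟩
  · obtain ⟨N, hN, hbN⟩ := (hmem b).1 hbc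
    exact (hc hN).2 hbN

namespace Submonoid.IsConvexPositive

variable {N : Submonoid L}

theorem one_le_of_mem_closure_insert [MulLeftMono L] (hN : N.IsConvexPositive) {x : L}
    (hx : 1 ≤ x) {q : L}
    (hq : q ∈ Submonoid.closure (insert x (N : Set L))) : 1 ≤ q := by
  induction hq using Submonoid.closure_induction with
  | mem q hq =>
    rcases hq with rfl | hq
    · exact hx
    · exact hN.one_le q hq
  | one => exact le_rfl
  | mul a b _ _ iha ihb => exact one_le_mul iha ihb

variable [MulLeftMono L] [MulRightMono L]

theorem _root_.inf_mul_le_inf_mul_inf {a b c : L} (ha : 1 ≤ a) (hb : 1 ≤ b) (hc : 1 ≤ c) :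
    a ⊓ b * c ≤ (a ⊓ b) * (a ⊓ c) := by
  rw [inf_mul, mul_inf, mul_inf]
  refine le_inf (le_inf ?_ ?_) (le_inf ?_ ?_)
  · exact inf_le_left.trans (le_mul_of_one_le_left' ha)
  · exact inf_le_left.trans (le_mul_of_one_le_right' hc)
  · exact inf_le_left.trans (le_mul_of_one_le_left' hb)
  · exact inf_le_right

/-- If the meet of `p` with `x` is in `N`, then so are its meets with all elements of the
submonoid generated by `x` and `N`. -/
theorem inf_mem_of_mem_closure_insert (hN : N.IsConvexPositive) {x p : L} (hx : 1 ≤ x)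
    (hp : 1 ≤ p) (hpx : p ⊓ x ∈ N) {q : L}
    (hq : q ∈ Submonoid.closure (insert x (N : Set L))) : p ⊓ q ∈ N := by
  induction hq using Submonoid.closure_induction with
  | mem q hq =>
    rcases hq with rfl | hq
    · exact hpx
    · exact hN.mem_of_le _ q (le_inf hp (hN.one_le q hq)) inf_le_right hq
  | one => simp [hp]
  | mul a b ha hb iha ihb =>
    have ha1 := hN.one_le_of_mem_closure_insert hx ha
    have hb1 := hN.one_le_of_mem_closure_insert hx hb
    exact hN.mem_of_le _ _ (le_inf hp (one_le_mul ha1 hb1))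
      (inf_mul_le_inf_mul_inf hp ha1 hb1) (mul_mem iha ihb)

/-- The convex positive submonoid generated by `N` and `x`. -/
def _root_.Submonoid.convexAdjoin (N : Submonoid L) (x : L) : Submonoid L where
  carrier := {p | 1 ≤ p ∧ ∃ q ∈ Submonoid.closure (insert x (N : Set L)), p ≤ q}
  one_mem' := ⟨le_rfl, 1, one_mem _, le_rfl⟩
  mul_mem' := by
    rintro a b ⟨ha, q, hq, haq⟩ ⟨hb, r, hr, hbr⟩
    exact ⟨one_le_mul ha hb, q * r, mul_mem hq hr, mul_le_mul' haq hbr⟩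

theorem exists_le_of_maximal {b : L}
    (hN : Maximal (fun N : Submonoid L => N.IsConvexPositive ∧ b ∉ N) N) {x : L} (hx : 1 ≤ x)
    (hxN : x ∉ N) : ∃ q ∈ Submonoid.closure (insert x (N : Set L)), b ≤ q := by
  by_contra! hcon
  have hle : N ≤ N.convexAdjoin x := fun a ha =>
    ⟨hN.prop.1.one_le a ha, a, Submonoid.subset_closure (Or.inr ha), le_rfl⟩
  have hadj : (N.convexAdjoin x).IsConvexPositive :=
    ⟨fun a ha => ha.1, fun a c h1 hac hc => ⟨h1, hc.2.imp fun q hq => ⟨hq.1, hac.trans hq.2⟩⟩⟩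
  have := hN.le_of_ge ⟨hadj, fun ⟨_, q, hq, hbq⟩ => hcon q hq hbq⟩ hle
  exact hxN (this ⟨hx, x, Submonoid.subset_closure (Or.inl rfl), le_rfl⟩)

theorem mem_or_mem_of_maximal {b : L} (hb : 1 ≤ b)
    (hN : Maximal (fun N : Submonoid L => N.IsConvexPositive ∧ b ∉ N) N) {x y : L}
    (hxy : x ⊓ y = 1) : x ∈ N ∨ y ∈ N := by
  by_contra! hcon
  have hx : 1 ≤ x := hxy ▸ inf_le_left
  have hy : 1 ≤ y := hxy ▸ inf_le_right
  obtain ⟨q, hq, hbq⟩ := exists_le_of_maximal hN hx hcon.1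
  obtain ⟨r, hr, hbr⟩ := exists_le_of_maximal hN hy hcon.2
  have hr1 := hN.prop.1.one_le_of_mem_closure_insert hy hr
  have hxr : x ⊓ r ∈ N :=
    hN.prop.1.inf_mem_of_mem_closure_insert hy hx (hxy ▸ one_mem N) hr
  have hrq : r ⊓ q ∈ N :=
    hN.prop.1.inf_mem_of_mem_closure_insert hx hr1 (inf_comm x r ▸ hxr) hq
  exact hN.prop.2 (hN.prop.1.mem_of_le _ _ hb (le_inf hbr hbq) hrq)

end Submonoid.IsConvexPositive

variable [MulLeftMono L] [MulRightMono L]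

/-- Every element `b ≱ 1` of a lattice-ordered group is strictly negative in a total right preorder
that extends the lattice order. The preorder is given by its nonpositive cone. -/
theorem exists_total_submonoid_of_not_one_le {b : L} (hb : ¬ 1 ≤ b) :
    ∃ Q : Submonoid L, (∀ a, a ≤ 1 → a ∈ Q) ∧ (∀ a, a ∈ Q ∨ a⁻¹ ∈ Q) ∧ b⁻¹ ∉ Q := by
  obtain ⟨N, hN⟩ := Submonoid.exists_maximal_isConvexPositive (b := b⁻¹ ⊔ 1)
    (fun h => hb (inv_le_one'.1 (sup_eq_right.1 h)))
  let Q : Submonoid L :=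
    { carrier := {a | a ⊔ 1 ∈ N}
      mul_mem' := fun {a c} ha hc => hN.prop.1.mem_of_le _ _ le_sup_right
        (sup_le (mul_le_mul' le_sup_left le_sup_left) (one_le_mul le_sup_right le_sup_right))
        (mul_mem ha hc)
      one_mem' := by simp }
  refine ⟨Q, fun a ha => ?_, fun a => ?_, hN.prop.2⟩
  · change a ⊔ 1 ∈ N
    simp [sup_eq_right.2 ha]
  · exact Submonoid.IsConvexPositive.mem_or_mem_of_maximal le_sup_right hN
      (oneLePart_inf_leOnePart_eq_one a)

end LatticeOrderedGroup

/-- A right order on `G` and a total right preorder on `H`, given by its nonnegative cone, combine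
lexicographically along a homomorphism `G → H`. -/
theorem IsRightOrder.extendsToRightOrder_comap {G H : Type*} [Group G] [Group H]
    {le : G → G → Prop} (hle : IsRightOrder le) (φ : G →* H) (Q : Submonoid H)
    (hQ : ∀ a, a ∈ Q ∨ a⁻¹ ∈ Q) : ExtendsToRightOrder {g | φ g⁻¹ ∉ Q} := by
  let P : Subsemigroup G :=
    { carrier := {g | φ g ∈ Q ∧ (φ g⁻¹ ∈ Q → g ∈ positiveCone le)}
      mul_mem' := by
        rintro a b ⟨ha, ha'⟩ ⟨hb, hb'⟩
        refine ⟨map_mul φ a b ▸ mul_mem ha hb, fun hab => hle.mul_mem_positiveCone ?_ ?_⟩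
        · exact ha' (by simpa using mul_mem hb hab)
        · exact hb' (by simpa using mul_mem hab ha) }
  refine ExtendsToRightOrder.mono ?_ (P.extendsToRightOrder ?_ ?_)
  · intro g hg
    exact ⟨(hQ (φ g)).resolve_right (by simpa using hg), fun h => absurd h hg⟩
  · intro h
    exact (h.2 (by simp)).2 rfl
  · intro a ha
    by_cases h1 : φ a ∈ Q <;> by_cases h2 : φ a⁻¹ ∈ Q
    · rcases hle.total a with h | h | h
      · exact Or.inl ⟨h1, fun _ => h⟩
      · exact Or.inr ⟨h2, fun _ => h⟩
      · exact absurd h ha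
    · exact Or.inl ⟨h1, fun h => absurd h h2⟩
    · exact Or.inr ⟨h2, fun h => absurd (by simpa using h) h1⟩
    · exact absurd (hQ (φ a)) (by simpa using ⟨h1, map_inv φ a ▸ h2⟩)

/-! ### The lattice-ordered group of automorphisms of a chain -/

namespace OrderIso

variable {α : Type*} [LinearOrder α]

instance : PartialOrder (α ≃o α) := PartialOrder.lift (fun f => (f : α → α)) DFunLike.coe_injective

theorem le_iff_forall_apply_le {f g : α ≃o α} : f ≤ g ↔ ∀ x, f x ≤ g x := Iff.rfl

/-- The pointwise maximum of two automorphisms of a chain. -/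
def pointwiseSup (f g : α ≃o α) : α ≃o α where
  toFun x := f x ⊔ g x
  invFun x := f.symm x ⊓ g.symm x
  left_inv x := by
    rcases le_total (f x) (g x) with h | h
    · simpa [h, g.symm_apply_apply] using (f.le_symm_apply).2 h
    · simpa [h, f.symm_apply_apply] using (g.le_symm_apply).2 h
  right_inv x := by
    rcases le_total (f.symm x) (g.symm x) with h | h
    · simpa [h] using (g.le_symm_apply).1 h
    · simpa [h] using (f.le_symm_apply).1 h
  map_rel_iff' := by
    intro x y
    have hmono : StrictMono fun x => f x ⊔ g x := fun a b hab =>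
      max_lt_max (f.strictMono hab) (g.strictMono hab)
    exact hmono.le_iff_le

/-- The pointwise minimum of two automorphisms of a chain. -/
def pointwiseInf (f g : α ≃o α) : α ≃o α := (pointwiseSup f.symm g.symm).symm

instance : Lattice (α ≃o α) where
  sup := pointwiseSup
  le_sup_left _ _ _ := le_sup_left
  le_sup_right _ _ _ := le_sup_right
  sup_le _ _ _ hf hg x := sup_le (hf x) (hg x)
  inf := pointwiseInf
  inf_le_left _ _ _ := inf_le_left
  inf_le_right _ _ _ := inf_le_right
  le_inf _ _ _ hf hg x := le_inf (hf x) (hg x)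

instance : MulLeftMono (α ≃o α) := ⟨fun f _ _ h x => f.monotone (h x)⟩

instance : MulRightMono (α ≃o α) := ⟨fun f _ _ h x => h (f x)⟩

theorem sup'_apply {ι : Type*} {s : Finset ι} (hs : s.Nonempty) (f : ι → α ≃o α) (x : α) :
    (s.sup' hs f) x = s.sup' hs fun i => f i x :=
  Finset.apply_sup'_eq_sup'_comp hs (fun f : α ≃o α => f x) fun _ _ => rfl

end OrderIso

/-- The linear order given by a right order. -/
noncomputable abbrev IsRightOrder.linearOrder {G : Type*} [Group G] {le : G → G → Prop}
    (h : IsRightOrder le) : LinearOrder G where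
  le := le
  le_refl := h.refl
  le_trans := h.trans
  le_antisymm := h.antisymm
  le_total a b := by
    rcases h.total (b * a⁻¹) with hab | hab | hab
    · exact Or.inl (by simpa using h.mul_right _ _ a hab.1)
    · exact Or.inr (by simpa using h.mul_right _ _ b hab.1)
    · exact Or.inl (mul_inv_eq_one.1 hab ▸ h.refl _)
  toDecidableLE := Classical.decRel _

/-- The right regular representation of a group by automorphisms of a right order on it. -/
def rightRegularOrderIso (G : Type*) [Group G] [LinearOrder G] [MulRightMono G] :
    G →* (G ≃o G) where
  toFun g := OrderIso.mulRight g⁻¹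
  map_one' := by ext; simp
  map_mul' a b := by ext; simp [mul_assoc]

/-! ### Validity in lattice-ordered groups -/

theorem GroupTerm.map_eval {k : ℕ} {G H : Type*} [Group G] [Group H] (φ : G →* H) (v : Fin k → G)
    (t : GroupTerm k) : φ (t.eval v) = t.eval (φ ∘ v) := by
  induction t with
  | var i => rfl
  | one => exact map_one φ
  | mul s t hs ht => simp [GroupTerm.eval, hs, ht]
  | inv t ht => simp [GroupTerm.eval, ht]

theorem GroupTerm.lift_toFree {k : ℕ} {G : Type*} [Group G] (v : Fin k → G) (t : GroupTerm k) :
    FreeGroup.lift v t.toFree = t.eval v := by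
  rw [GroupTerm.toFree, GroupTerm.map_eval]
  congr 1
  ext i
  simp

theorem ValidInLGroups.not_extendsToRightOrder {k n : ℕ} [NeZero n] {t : Fin n → GroupTerm k}
    (h : ValidInLGroups.{u} t) : ¬ ExtendsToRightOrder (Set.range fun i => (t i).toFree) := by
  rintro ⟨le, hle, ht⟩
  let : LinearOrder (FreeGroup (Fin k)) := hle.linearOrder
  have : MulRightMono (FreeGroup (Fin k)) := ⟨fun c a b hab => hle.mul_right a b c hab⟩
  have : MulRightMono (ULift.{u} (FreeGroup (Fin k))) := ⟨fun c a b hab =>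
    hle.mul_right a.down b.down c.down hab⟩
  let ρ : FreeGroup (Fin k) →* _ :=
    (rightRegularOrderIso (ULift.{u} (FreeGroup (Fin k)))).comp MulEquiv.ulift.symm.toMonoidHom
  have hv := h (ULift.{u} (FreeGroup (Fin k)) ≃o ULift.{u} (FreeGroup (Fin k)))
    (ρ ∘ FreeGroup.of)
  simp only [← GroupTerm.map_eval] at hv
  have h1 := OrderIso.le_iff_forall_apply_le.1 hv 1
  rw [OrderIso.sup'_apply, Finset.le_sup'_iff] at h1
  obtain ⟨i, -, hi⟩ := h1
  have hi' : le 1 (1 * (t i).toFree⁻¹) := hi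
  have hti := ht ⟨i, rfl⟩
  have hle1 : le (t i).toFree 1 := by simpa using hle.mul_right _ _ (t i).toFree hi'
  exact hti.2 (hle.antisymm _ _ hle1 hti.1)

theorem validInLGroups_of_not_extendsToRightOrder {k n : ℕ} [NeZero n] {t : Fin n → GroupTerm k}
    (h : ¬ ExtendsToRightOrder (Set.range fun i => (t i).toFree)) : ValidInLGroups.{u} t := by
  intro L _ _ _ _ v
  by_contra hcon
  obtain ⟨Q, hneg, htot, hQ⟩ := exists_total_submonoid_of_not_one_le hcon
  obtain ⟨le, hle⟩ := IsFreeGroup.exists_isRightOrder (G := FreeGroup (Fin k))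
  refine h ((hle.extendsToRightOrder_comap (FreeGroup.lift v) Q htot).mono ?_)
  rintro _ ⟨i, rfl⟩ hi
  rw [map_inv, GroupTerm.lift_toFree] at hi
  have hle_sup := Finset.le_sup' (fun i => (t i).eval v) (Finset.mem_univ i)
  exact hQ (by simpa using mul_mem (hneg _ (inv_mul_le_one_iff.2 hle_sup)) hi)

theorem theoremt (k n : ℕ) [NeZero n] (t : Fin n → GroupTerm k) :
    List.TFAE
      [ValidInLGroups.{u} t,
       ¬ ExtendsToRightOrder (Set.range fun i => (t i).toFree),
       ∃ (m : ℕ) (s : Fin m → FreeGroup (Fin k)), (∀ j, s j ≠ 1) ∧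
         ∀ δ : Fin m → ℤˣ,
           (1 : FreeGroup (Fin k)) ∈ Subsemigroup.closure
             ((Set.range fun i => (t i).toFree) ∪ Set.range fun j => s j ^ (δ j : ℤ))] := by
  tfae_have 1 ↔ 2 := ⟨fun h => h.not_extendsToRightOrder,
    validInLGroups_of_not_extendsToRightOrder⟩
  tfae_have 2 ↔ 3 := not_extendsToRightOrder_iff _
  tfae_finish
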